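/- Let $K\ge 1$ be an integer and let $0<q_1<q_0<1$. For $x\in[0,1]$ put $B_K(x)=\mathbb P(\mathrm{Bin}(2K,x)\ge K+1)=\sum_{i=K+1}^{2K}\binom{2K}{i}x^i(1-x)^{2K-i}$, and for $x\in(0,1)$ put $$g_K(x)=\frac{\frac1x B_K(x)}{\frac1{1-x}B_K(1-x)}.$$ There is exactly one $\beta\in(0,1)$ with $g_K(\beta)=q_1/q_0$. For $N\ge1$ let $X^{(N)}$ be the continuous-time Markov chain on $\{0,1,\dots,N\}$ (the number of agents with opinion $1$ under the biased majority rule) whose only non-zero transition rates are $$q(n\to n+1)=(N-n)\,q_0\,B_K\!\left(\tfrac nN\right),\qquad q(n\to n-1)=n\,q_1\,B_K\!\left(1-\tfrac nN\right),$$ so that $0$ and $N$ are absorbing. Let $T_k=\inf\{t\ge0: X^{(N)}(t)=k\}$ and, for $\alpha\in(0,1)$, let $t_N(\alpha)=\mathbb E_{\lfloor\alpha N\rfloor}[T_0\wedge T_N]$ be the mean time to consensus when $X^{(N)}(0)=\lfloor\alpha N\rfloor$. Then, for every $\alpha\in(0,\beta)\cup(\beta,1)$, $t_N(\alpha)$ is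 finite for every $N$ and $$t_N(\alpha)=\Theta(\log N)\qquad(N\to\infty),$$ where the implied constants may depend on $K,q_0,q_1,\alpha$ but not on $N$. -/

import Mathlib

open MeasureTheory ProbabilityTheory Set Filter Asymptotics
open scoped NNReal ENNReal

noncomputable section

/-! ### Continuous-time Markov chains on a finite state space

A chain is given by its transition rates `q i j` (`i ≠ j`). It is constructed from its embedded
jump chain and independent unit-rate exponential clocks: in a state `i` of total exit rate
`λ i > 0` the chain stays for a time `E / λ i`, with `E` a fresh unit-rate exponential variable,
and then jumps to `j` with probability `q i j / λ i`; a state with `λ i = 0` is absorbing. -/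

namespace CTMC

variable {S : Type*} [Fintype S] [DecidableEq S]

/-- The rate at which the chain moves from `i` to `j`; the diagonal is ignored. -/
def offDiag (q : S → S → ℝ≥0) (i j : S) : ℝ≥0 := if j = i then 0 else q i j

/-- The total rate at which the chain leaves the state `i`. -/
def exitRate (q : S → S → ℝ≥0) (i : S) : ℝ≥0 := ∑ j, offDiag q i j

theorem tsum_offDiag (q : S → S → ℝ≥0) (i : S) :
    ∑' j, (offDiag q i j : ℝ≥0∞) = (exitRate q i : ℝ≥0∞) := by
  rw [tsum_fintype, exitRate, ENNReal.ofNNReal_finsetSum]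

/-- The law of the next state of the embedded jump chain: from `i` the chain jumps to `j ≠ i` with
probability `q i j / exitRate q i`, and it stays at `i` forever if `exitRate q i = 0`. -/
def jumpPMF (q : S → S → ℝ≥0) (i : S) : PMF S :=
  if h : exitRate q i = 0 then PMF.pure i
  else PMF.normalize (fun j => (offDiag q i j : ℝ≥0∞))
    (by rw [tsum_offDiag]; exact ENNReal.coe_ne_zero.mpr h)
    (by rw [tsum_offDiag]; exact ENNReal.coe_ne_top)

variable [MeasurableSpace S] [MeasurableSingletonClass S]

/-- The transition kernel of the embedded jump chain. -/
def jumpKernel (q : S → S → ℝ≥0) : Kernel S S :=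
  Kernel.ofFunOfCountable fun i => (jumpPMF q i).toMeasure

instance (q : S → S → ℝ≥0) : IsMarkovKernel (jumpKernel q) :=
  ⟨fun i => inferInstanceAs (IsProbabilityMeasure (jumpPMF q i).toMeasure)⟩

/-- The same kernel, from histories `(Y 0, …, Y n)` to the next state `Y (n + 1)`; it depends on
the history through `Y n` only. -/
def stepKernel (q : S → S → ℝ≥0) (n : ℕ) : Kernel ((i : Finset.Iic n) → S) S :=
  (jumpKernel q).comap (fun h => h ⟨n, Finset.mem_Iic.mpr le_rfl⟩) (measurable_pi_apply _)

instance (q : S → S → ℝ≥0) (n : ℕ) : IsMarkovKernel (stepKernel q n) := by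
  unfold stepKernel; infer_instance

/-- The law of the embedded jump chain `Y 0, Y 1, …` started at `x`. -/
def jumpChainLaw (q : S → S → ℝ≥0) (x : S) : Measure (ℕ → S) :=
  Kernel.trajMeasure (X := fun _ => S) (Measure.dirac x) (stepKernel q)

/-- The probability measure `ℙ_x` on pairs `(Y, E)`: the jump chain `Y` starts at `x`, and
`E 0, E 1, …` are independent unit-rate exponential variables, independent of `Y`. -/
def law (q : S → S → ℝ≥0) (x : S) : Measure ((ℕ → S) × (ℕ → ℝ)) :=
  (jumpChainLaw q x).prod (Measure.infinitePi fun _ : ℕ => expMeasure 1)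

/-- The time spent in the `k`-th visited state `Y k`, exponential with rate `exitRate q (Y k)`;
it is infinite (almost surely) if that rate is `0`. -/
def holdingTime (q : S → S → ℝ≥0) (ω : (ℕ → S) × (ℕ → ℝ)) (k : ℕ) : ℝ≥0∞ :=
  ENNReal.ofReal (ω.2 k) / (exitRate q (ω.1 k) : ℝ≥0∞)

/-- The time of the `n`-th jump; `jumpTime q ω 0 = 0`. -/
def jumpTime (q : S → S → ℝ≥0) (ω : (ℕ → S) × (ℕ → ℝ)) (n : ℕ) : ℝ≥0∞ :=
  ∑ k ∈ Finset.range n, holdingTime q ω k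

/-- The state `X(t)` of the chain at time `t`: it is `Y n` for
`jumpTime n ≤ t < jumpTime (n + 1)`. (On a finite state space, the jump times exhaust the half
line almost surely, so that such an `n` exists.) -/
def process (q : S → S → ℝ≥0) (ω : (ℕ → S) × (ℕ → ℝ)) (t : ℝ≥0) : S :=
  ω.1 (sInf {n : ℕ | (t : ℝ≥0∞) < jumpTime q ω (n + 1)})

/-- The first time `inf {t ≥ 0 : X(t) = a}` at which the chain is in state `a`
(infinite if it never is). -/
def hittingTime (q : S → S → ℝ≥0) (a : S) (ω : (ℕ → S) × (ℕ → ℝ)) : ℝ≥0∞ :=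
  ⨅ (t : ℝ≥0) (_ : process q ω t = a), (t : ℝ≥0∞)

end CTMC

/-! ### The biased majority rule -/

namespace MajorityRule

/-- `ℙ(Bin(2K, x) ≥ K + 1)`. -/
def binTail (K : ℕ) (x : ℝ) : ℝ :=
  ∑ i ∈ Finset.Icc (K + 1) (2 * K), ((2 * K).choose i : ℝ) * x ^ i * (1 - x) ^ (2 * K - i)

/-- The rate of the jump `n → n + 1` of the number of agents with opinion `1` among `N` agents. -/
def upRate (K : ℕ) (q₀ : ℝ) (N n : ℕ) : ℝ :=
  ((N : ℝ) - n) * q₀ * binTail K (n / N)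

/-- The rate of the jump `n → n - 1` of the number of agents with opinion `1` among `N` agents. -/
def downRate (K : ℕ) (q₁ : ℝ) (N n : ℕ) : ℝ :=
  (n : ℝ) * q₁ * binTail K (1 - n / N)

/-- The transition rates, on `{0, 1, …, N}`, of the number of agents with opinion `1`. -/
def rate (K : ℕ) (q₀ q₁ : ℝ) (N : ℕ) (m n : Fin (N + 1)) : ℝ≥0 :=
  if (n : ℕ) = m + 1 then (upRate K q₀ N m).toNNReal
  else if (n : ℕ) + 1 = m then (downRate K q₁ N m).toNNReal
  else 0

/-- The consensus time `T₀ ∧ T_N`. -/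
def consensusTime (K : ℕ) (q₀ q₁ : ℝ) (N : ℕ) (ω : (ℕ → Fin (N + 1)) × (ℕ → ℝ)) : ℝ≥0∞ :=
  min (CTMC.hittingTime (rate K q₀ q₁ N) 0 ω)
    (CTMC.hittingTime (rate K q₀ q₁ N) (Fin.last N) ω)

/-- The mean consensus time `𝔼_x[T₀ ∧ T_N]`, an element of `[0, ∞]`. -/
def meanConsensusTime (K : ℕ) (q₀ q₁ : ℝ) (N : ℕ) (x : Fin (N + 1)) : ℝ≥0∞ :=
  ∫⁻ ω, consensusTime K q₀ q₁ N ω ∂(CTMC.law (rate K q₀ q₁ N) x)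

/-- The initial state `⌊α N⌋`. -/
def initialState (α : ℝ) (hα : α ∈ Ioo (0 : ℝ) 1) (N : ℕ) : Fin (N + 1) :=
  ⟨⌊α * N⌋₊, Nat.lt_succ_of_le (Nat.floor_le_of_le
    (mul_le_of_le_one_left (Nat.cast_nonneg N) hα.2.le))⟩

/-- The function `g_K` on `(0, 1)`. -/
def gK (K : ℕ) (x : ℝ) : ℝ :=
  (1 / x * binTail K x) / (1 / (1 - x) * binTail K (1 - x))

end MajorityRule

end

/-! Consensus is absorption, and almost surely the consensus time is the total time spent in
non-absorbing states once its mean is finite. That mean is the expected sum of the mean holding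
times along the jump chain, so Lyapunov functions bound it: a nonnegative `W` whose generator is at
most `-1` in the interior is an upper bound, and one with generator at least `-1` that vanishes at
both ends is a lower bound.

Upper bound: `g_K(x)(1 - x)/x` is nondecreasing (`binTail_mul_le`), so `g_K` is strictly increasing
and the up/down ratio `g_K(n/N)/g_K(β)` differs from `1` at least linearly in the distance of `n/N`
from `β`, with drift away from `β`. The first-step equations on either side of `β` are then solved
explicitly (`exists_increments`, `exists_potential`), and partial fractions bound the solution by a
multiple of `harm N`, uniformly in the initial state.

Lower bound: the rates satisfy `u ≤ N - n` and `v ≤ n`, so `(harm n + harm (N - n) - harm N) / 2` is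
a subsolution; at `n = ⌊αN⌋` it is of order `log N`. -/

namespace CTMC

variable {S : Type*} [Fintype S] [DecidableEq S]

/-! ### The jump operator and mean holding times -/

theorem jumpPMF_apply {q : S → S → ℝ≥0} {i : S} (h : exitRate q i ≠ 0) (j : S) :
    jumpPMF q i j = offDiag q i j * (exitRate q i : ℝ≥0∞)⁻¹ := by
  rw [jumpPMF, dif_neg h, PMF.normalize_apply, tsum_offDiag]

theorem jumpPMF_of_exitRate_eq_zero {q : S → S → ℝ≥0} {i : S} (h : exitRate q i = 0) :
    jumpPMF q i = PMF.pure i := by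
  rw [jumpPMF, dif_pos h]

/-- The transition operator of the embedded jump chain. -/
noncomputable def jumpOp (q : S → S → ℝ≥0) (V : S → ℝ≥0∞) (i : S) : ℝ≥0∞ :=
  ∑ j, jumpPMF q i j * V j

theorem jumpOp_of_exitRate_eq_zero {q : S → S → ℝ≥0} {i : S} (h : exitRate q i = 0)
    (V : S → ℝ≥0∞) : jumpOp q V i = V i := by
  simp [jumpOp, jumpPMF_of_exitRate_eq_zero h, PMF.pure_apply]

theorem jumpOp_of_exitRate_ne_zero {q : S → S → ℝ≥0} {i : S} (h : exitRate q i ≠ 0)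
    (V : S → ℝ≥0∞) :
    jumpOp q V i = (∑ j, offDiag q i j * V j) * (exitRate q i : ℝ≥0∞)⁻¹ := by
  simp only [jumpOp, jumpPMF_apply h, Finset.sum_mul]
  exact Finset.sum_congr rfl fun j _ => by ring

/-- The mean holding time in a state, set to `0` at absorbing states. -/
noncomputable def meanHolding (q : S → S → ℝ≥0) (i : S) : ℝ≥0∞ :=
  if exitRate q i = 0 then 0 else (exitRate q i : ℝ≥0∞)⁻¹

/-- Dividing by the exit rate turns a generator inequality into one for the jump chain; at an
absorbing state it is trivial because `meanHolding` is `0` there. -/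
theorem meanHolding_add_jumpOp_le {q : S → S → ℝ≥0} {V : S → ℝ≥0∞} {i : S}
    (h : exitRate q i ≠ 0 → 1 + ∑ j, offDiag q i j * V j ≤ exitRate q i * V i) :
    meanHolding q i + jumpOp q V i ≤ V i := by
  by_cases hi : exitRate q i = 0
  · simp [meanHolding, hi, jumpOp_of_exitRate_eq_zero hi]
  · rw [meanHolding, if_neg hi, jumpOp_of_exitRate_ne_zero hi, ← one_add_mul,
      ← div_eq_mul_inv]
    exact ENNReal.div_le_of_le_mul' (h hi)

theorem le_meanHolding_add_jumpOp {q : S → S → ℝ≥0} {V : S → ℝ≥0∞} {i : S}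
    (h : exitRate q i ≠ 0 → exitRate q i * V i ≤ 1 + ∑ j, offDiag q i j * V j) :
    V i ≤ meanHolding q i + jumpOp q V i := by
  by_cases hi : exitRate q i = 0
  · simp [meanHolding, hi, jumpOp_of_exitRate_eq_zero hi]
  · have h0 : (exitRate q i : ℝ≥0∞) ≠ 0 := by simpa using hi
    rw [meanHolding, if_neg hi, jumpOp_of_exitRate_ne_zero hi, ← one_add_mul,
      ← div_eq_mul_inv, ENNReal.le_div_iff_mul_le (Or.inl h0) (Or.inl ENNReal.coe_ne_top), mul_comm]
    exact h hi

/-- The total time spent in non-absorbing states. -/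
noncomputable def activeTime (q : S → S → ℝ≥0) (ω : (ℕ → S) × (ℕ → ℝ)) : ℝ≥0∞ :=
  ∑' k, ENNReal.ofReal (ω.2 k) * meanHolding q (ω.1 k)

/-! ### Absorption time along a single path -/

theorem absorbed_of_le {q : S → S → ℝ≥0} {Y : ℕ → S}
    (h : ∀ k, exitRate q (Y k) = 0 → Y (k + 1) = Y k) {m n : ℕ} (hmn : m ≤ n)
    (hm : exitRate q (Y m) = 0) : exitRate q (Y n) = 0 := by
  induction n, hmn using Nat.le_induction with
  | base => exact hm
  | succ n _ ih => rw [h n ih, ih]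

theorem jumpTime_mono (q : S → S → ℝ≥0) (ω : (ℕ → S) × (ℕ → ℝ)) : Monotone (jumpTime q ω) :=
  fun _ _ h => Finset.sum_le_sum_of_subset (Finset.range_mono h)

theorem holdingTime_of_ne_zero {q : S → S → ℝ≥0} {ω : (ℕ → S) × (ℕ → ℝ)} {k : ℕ}
    (h : exitRate q (ω.1 k) ≠ 0) :
    holdingTime q ω k = ENNReal.ofReal (ω.2 k) * meanHolding q (ω.1 k) := by
  rw [holdingTime, meanHolding, if_neg h, div_eq_mul_inv]

theorem jumpTime_find_eq_activeTime {q : S → S → ℝ≥0} {ω : (ℕ → S) × (ℕ → ℝ)}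
    (habs : ∀ k, exitRate q (ω.1 k) = 0 → ω.1 (k + 1) = ω.1 k)
    {n : ℕ} (hn : exitRate q (ω.1 n) = 0) (hlt : ∀ k < n, exitRate q (ω.1 k) ≠ 0) :
    jumpTime q ω n = activeTime q ω := by
  rw [activeTime, tsum_eq_sum (s := Finset.range n), jumpTime]
  · exact Finset.sum_congr rfl fun k hk => holdingTime_of_ne_zero (hlt k (Finset.mem_range.mp hk))
  · intro k hk
    rw [meanHolding, if_pos (absorbed_of_le habs (by simpa using hk) hn), mul_zero]

theorem jumpTime_succ_eq_top {q : S → S → ℝ≥0} {ω : (ℕ → S) × (ℕ → ℝ)} {n : ℕ}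
    (hpos : 0 < ω.2 n) (hn : exitRate q (ω.1 n) = 0) : jumpTime q ω (n + 1) = ∞ := by
  rw [jumpTime, Finset.sum_range_succ, holdingTime, hn, ENNReal.coe_zero,
    ENNReal.div_zero (by simpa using hpos), add_top]

/-- Let `n` be the first index with an absorbing state. The `n`-th jump time is finite and equals
the active time, while jump `n + 1` never happens. So the process sits in `Y n` from that moment on
and visits no absorbing state earlier. -/
theorem hittingTime_eq_activeTime {q : S → S → ℝ≥0} {ω : (ℕ → S) × (ℕ → ℝ)}
    (habs : ∀ k, exitRate q (ω.1 k) = 0 → ω.1 (k + 1) = ω.1 k)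
    (hpos : ∀ k, 0 < ω.2 k) (hhit : ∃ k, exitRate q (ω.1 k) = 0) :
    (∃ a, exitRate q a = 0 ∧ hittingTime q a ω ≤ activeTime q ω) ∧
      ∀ a, exitRate q a = 0 → activeTime q ω ≤ hittingTime q a ω := by
  classical
  obtain ⟨n, hn, hlt⟩ : ∃ n, exitRate q (ω.1 n) = 0 ∧ ∀ k < n, exitRate q (ω.1 k) ≠ 0 :=
    ⟨Nat.find hhit, Nat.find_spec hhit, fun k hk => Nat.find_min hhit hk⟩
  have hT := jumpTime_find_eq_activeTime habs hn hlt
  have htop := jumpTime_succ_eq_top (hpos n) hn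
  constructor
  · refine ⟨ω.1 n, hn, ?_⟩
    have hne : jumpTime q ω n ≠ ∞ := by
      rw [jumpTime]
      refine (ENNReal.sum_lt_top.mpr fun k hk => ?_).ne
      exact ENNReal.div_lt_top ENNReal.ofReal_ne_top
        (by simpa using hlt k (Finset.mem_range.mp hk))
    have hs : sInf {m : ℕ | ((jumpTime q ω n).toNNReal : ℝ≥0∞) < jumpTime q ω (m + 1)} = n := by
      rw [ENNReal.coe_toNNReal hne]
      refine le_antisymm (Nat.sInf_le (by simpa [htop] using hne.lt_top)) ?_
      refine le_csInf ⟨n, by simpa [htop] using hne.lt_top⟩ fun m hm => ?_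
      by_contra! hmn
      exact absurd (jumpTime_mono q ω hmn) (not_le.mpr hm)
    rw [← hT]
    refine (iInf₂_le (jumpTime q ω n).toNNReal ?_).trans (ENNReal.coe_toNNReal hne).le
    rw [process, hs]
  · intro a ha
    refine le_iInf₂ fun t ht => ?_
    have hne : {m : ℕ | (t : ℝ≥0∞) < jumpTime q ω (m + 1)}.Nonempty :=
      ⟨n, by simp [htop]⟩
    rw [process] at ht
    set s := sInf {m : ℕ | (t : ℝ≥0∞) < jumpTime q ω (m + 1)} with hs
    have hns : n ≤ s := by
      by_contra! h
      exact hlt s h (by rw [ht, ha])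
    rw [← hT]
    rcases Nat.eq_zero_or_pos s with h0 | h0
    · have : n = 0 := by omega
      simp [this, jumpTime]
    · refine (jumpTime_mono q ω hns).trans ?_
      -- Minimality of `s` at index `s - 1` says that `jumpTime s ≤ t`.
      have := Nat.notMem_of_lt_sInf (s := {m : ℕ | (t : ℝ≥0∞) < jumpTime q ω (m + 1)})
        (m := s - 1) (by omega)
      rw [mem_ofPred_eq, not_lt, Nat.sub_add_cancel h0] at this
      exact this

/-! ### Lyapunov bounds for the jump chain -/

variable [MeasurableSpace S] [MeasurableSingletonClass S]

theorem measurable_comp_coord {T : Type*} [Countable T] [MeasurableSpace T]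
    [MeasurableSingletonClass T] (f : T → ℝ≥0∞) (k : ℕ) : Measurable fun Y : ℕ → T => f (Y k) :=
  (Measurable.of_discrete (f := f)).comp (measurable_pi_apply k)

theorem lintegral_jumpKernel (q : S → S → ℝ≥0) (i : S) (f : S → ℝ≥0∞) :
    ∫⁻ j, f j ∂(jumpKernel q i) = ∑ j, jumpPMF q i j * f j := by
  rw [lintegral_fintype]
  refine Finset.sum_congr rfl fun j _ => ?_
  rw [mul_comm]
  congr 1
  exact PMF.toMeasure_apply_singleton _ _ (measurableSet_singleton j)

instance (q : S → S → ℝ≥0) (x : S) : IsProbabilityMeasure (jumpChainLaw q x) := by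
  unfold jumpChainLaw; infer_instance

/-- One-step Markov property: the joint law of the history up to `k` and the next state is the
composition-product with `stepKernel`, which reads only the last coordinate. -/
theorem lintegral_jumpChainLaw_succ (q : S → S → ℝ≥0) (x : S) (k : ℕ) (f : S → S → ℝ≥0∞) :
    ∫⁻ Y, f (Y k) (Y (k + 1)) ∂(jumpChainLaw q x) =
      ∫⁻ Y, ∑ j, jumpPMF q (Y k) j * f (Y k) j ∂(jumpChainLaw q x) := by
  have key := Kernel.map_frestrictLe_trajMeasure_compProd_eq_map_trajMeasure
    (X := fun _ => S) (μ₀ := Measure.dirac x) (κ := stepKernel q) (a := k)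
  have hf : Measurable (fun p : S × S => f p.1 p.2) := Measurable.of_discrete
  let F : ((i : Finset.Iic k) → S) × S → ℝ≥0∞ :=
    fun p => f (p.1 ⟨k, Finset.mem_Iic.mpr le_rfl⟩) p.2
  have hF : Measurable F :=
    hf.comp (g := fun p : S × S => f p.1 p.2)
      (f := fun p : ((i : Finset.Iic k) → S) × S => (p.1 ⟨k, Finset.mem_Iic.mpr le_rfl⟩, p.2))
      (((measurable_pi_apply _).comp measurable_fst).prodMk measurable_snd)
  have h1 : ∫⁻ Y, f (Y k) (Y (k + 1)) ∂(jumpChainLaw q x) =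
      ∫⁻ p, F p ∂((jumpChainLaw q x).map
        (fun Y => (Preorder.frestrictLe (π := fun _ => S) k Y, Y (k + 1)))) := by
    rw [lintegral_map hF (by fun_prop)]
    rfl
  rw [h1, jumpChainLaw, ← key, Measure.lintegral_compProd hF, lintegral_map _ (by fun_prop)]
  · refine lintegral_congr fun Y => ?_
    exact lintegral_jumpKernel q (Y k) (f (Y k))
  · exact hF.lintegral_kernel_prod_right'

theorem lintegral_jumpChainLaw_zero (q : S → S → ℝ≥0) (x : S) (f : S → ℝ≥0∞) :
    ∫⁻ Y, f (Y 0) ∂(jumpChainLaw q x) = f x := by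
  have hf : Measurable fun h : (i : Finset.Iic 0) → S => f (h ⟨0, Finset.mem_Iic.mpr le_rfl⟩) :=
    (Measurable.of_discrete (f := f)).comp (measurable_pi_apply _)
  have h1 : ∫⁻ Y, f (Y 0) ∂(jumpChainLaw q x) =
      ∫⁻ h, f (h ⟨0, Finset.mem_Iic.mpr le_rfl⟩) ∂((jumpChainLaw q x).map
        (Preorder.frestrictLe (π := fun _ => S) 0)) := by
    rw [lintegral_map hf (by fun_prop)]
    rfl
  rw [h1, jumpChainLaw, Kernel.trajMeasure, Measure.map_comp _ _ (by fun_prop),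
    Kernel.traj_map_frestrictLe, Kernel.partialTraj_self, Measure.id_comp,
    lintegral_map hf (by fun_prop), lintegral_dirac]
  rfl

/-- A discrete Dynkin formula: by the Markov property the left side does not increase with `n`. -/
theorem sum_meanHolding_add_le {q : S → S → ℝ≥0} {V : S → ℝ≥0∞}
    (hV : ∀ i, meanHolding q i + jumpOp q V i ≤ V i) (x : S) (n : ℕ) :
    ∑ k ∈ Finset.range n, ∫⁻ Y, meanHolding q (Y k) ∂(jumpChainLaw q x) +
      ∫⁻ Y, V (Y n) ∂(jumpChainLaw q x) ≤ V x := by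
  induction n with
  | zero => simp [lintegral_jumpChainLaw_zero]
  | succ n ih =>
    refine le_trans ?_ ih
    rw [Finset.sum_range_succ, add_assoc, lintegral_jumpChainLaw_succ q x n (fun _ j => V j),
      ← lintegral_add_left (measurable_comp_coord _ n)]
    gcongr with Y
    exact hV (Y n)

theorem le_sum_meanHolding_add {q : S → S → ℝ≥0} {V : S → ℝ≥0∞}
    (hV : ∀ i, V i ≤ meanHolding q i + jumpOp q V i) (x : S) (n : ℕ) :
    V x ≤ ∑ k ∈ Finset.range n, ∫⁻ Y, meanHolding q (Y k) ∂(jumpChainLaw q x) +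
      ∫⁻ Y, V (Y n) ∂(jumpChainLaw q x) := by
  induction n with
  | zero => simp [lintegral_jumpChainLaw_zero]
  | succ n ih =>
    refine ih.trans ?_
    rw [Finset.sum_range_succ, add_assoc, lintegral_jumpChainLaw_succ q x n (fun _ j => V j),
      ← lintegral_add_left (measurable_comp_coord _ n)]
    gcongr with Y
    exact hV (Y n)

theorem tsum_meanHolding_le {q : S → S → ℝ≥0} {V : S → ℝ≥0∞}
    (hV : ∀ i, meanHolding q i + jumpOp q V i ≤ V i) (x : S) :
    ∑' k, ∫⁻ Y, meanHolding q (Y k) ∂(jumpChainLaw q x) ≤ V x :=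
  ENNReal.tsum_le_of_sum_range_le fun n => le_self_add.trans (sum_meanHolding_add_le hV x n)

/-- Domination by `M * meanHolding` makes the remainder `𝔼 V(Y n)` at most `M` times a term of a
convergent series, so it tends to `0`. -/
theorem le_tsum_meanHolding {q : S → S → ℝ≥0} {V : S → ℝ≥0∞} {M : ℝ≥0∞} (hM : M ≠ ∞)
    (hV : ∀ i, V i ≤ meanHolding q i + jumpOp q V i) (hVM : ∀ i, V i ≤ M * meanHolding q i)
    (x : S) (hfin : ∑' k, ∫⁻ Y, meanHolding q (Y k) ∂(jumpChainLaw q x) ≠ ∞) :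
    V x ≤ ∑' k, ∫⁻ Y, meanHolding q (Y k) ∂(jumpChainLaw q x) := by
  have h0 := ENNReal.tendsto_atTop_zero_of_tsum_ne_top hfin
  have h1 := (ENNReal.tendsto_nat_tsum
    (fun k => ∫⁻ Y, meanHolding q (Y k) ∂(jumpChainLaw q x))).add
      (ENNReal.Tendsto.const_mul h0 (Or.inr hM))
  rw [mul_zero, add_zero] at h1
  refine ge_of_tendsto' h1 fun n => (le_sum_meanHolding_add hV x n).trans ?_
  rw [← lintegral_const_mul _ (measurable_comp_coord _ n)]
  gcongr with Y
  exact hVM (Y n)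

/-! ### Exponential clocks and almost sure absorption -/

instance : IsProbabilityMeasure (expMeasure 1) := isProbabilityMeasure_expMeasure one_pos

theorem measurable_gammaPDF (a r : ℝ) : Measurable (gammaPDF a r) :=
  (measurable_gammaPDFReal a r).ennreal_ofReal

theorem lintegral_id_expMeasure_one : ∫⁻ x, ENNReal.ofReal x ∂(expMeasure 1) = 1 := by
  -- The factor `x` turns the Gamma(1, 1) density into the Gamma(2, 1) density, which has total mass
  -- `1`.
  rw [expMeasure, gammaMeasure, lintegral_withDensity_eq_lintegral_mul _ (measurable_gammaPDF 1 1)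
    ENNReal.measurable_ofReal, ← lintegral_gammaPDF_eq_one two_pos one_pos]
  refine lintegral_congr fun x => ?_
  rw [Pi.mul_apply, gammaPDF_eq, gammaPDF_eq]
  split_ifs with hx
  · rw [← ENNReal.ofReal_mul (by positivity)]
    congr 1
    norm_num
    ring
  · simp

theorem ae_pos_expMeasure_one : ∀ᵐ x ∂(expMeasure 1), 0 < x := by
  rw [expMeasure, gammaMeasure, ae_withDensity_iff (measurable_gammaPDF 1 1)]
  filter_upwards [compl_mem_ae_iff.mpr (measure_singleton (0 : ℝ))] with x hx0 hx
  by_contra! h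
  exact hx (gammaPDF_of_neg (lt_of_le_of_ne h hx0))

theorem lintegral_activeTime (q : S → S → ℝ≥0) (x : S) :
    ∫⁻ ω, activeTime q ω ∂(law q x) =
      ∑' k, ∫⁻ Y, meanHolding q (Y k) ∂(jumpChainLaw q x) := by
  have hm : ∀ k, Measurable fun Y : ℕ → S => meanHolding q (Y k) := 
    measurable_comp_coord _
  have hE : ∀ k, Measurable fun E : ℕ → ℝ => ENNReal.ofReal (E k) := fun k =>
    ENNReal.measurable_ofReal.comp (measurable_pi_apply k)
  unfold activeTime
  have hp : ∀ k, Measurable fun ω : (ℕ → S) × (ℕ → ℝ) =>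
      ENNReal.ofReal (ω.2 k) * meanHolding q (ω.1 k) := fun k =>
    ((hE k).comp measurable_snd).mul ((hm k).comp measurable_fst)
  rw [lintegral_tsum fun k => (hp k).aemeasurable]
  refine tsum_congr fun k => ?_
  simp_rw [mul_comm (ENNReal.ofReal _)]
  rw [law, lintegral_prod_mul (hm k).aemeasurable (hE k).aemeasurable]
  have : ∫⁻ E : ℕ → ℝ, ENNReal.ofReal (E k) ∂(Measure.infinitePi fun _ : ℕ => expMeasure 1) = 1 := by
    have h := lintegral_map (μ := Measure.infinitePi fun _ : ℕ => expMeasure 1)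
      ENNReal.measurable_ofReal (measurable_pi_apply k)
    rw [Measure.infinitePi_map_eval, lintegral_id_expMeasure_one] at h
    exact h.symm
  rw [this, mul_one]

theorem ae_jumpChainLaw_absorbed (q : S → S → ℝ≥0) (x : S) :
    ∀ᵐ Y ∂(jumpChainLaw q x), ∀ k, exitRate q (Y k) = 0 → Y (k + 1) = Y k := by
  rw [ae_all_iff]
  intro k
  classical
  have h := lintegral_jumpChainLaw_succ q x k
    (fun i j => if exitRate q i = 0 ∧ j ≠ i then 1 else 0)
  have h2 : ∀ Y : ℕ → S, ∑ j, jumpPMF q (Y k) j *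
      (if exitRate q (Y k) = 0 ∧ j ≠ Y k then 1 else 0 : ℝ≥0∞) = 0 := by
    intro Y
    refine Finset.sum_eq_zero fun j _ => ?_
    split_ifs with hj
    · rw [jumpPMF_of_exitRate_eq_zero hj.1, PMF.pure_apply, if_neg hj.2, zero_mul]
    · rw [mul_zero]
  simp only [h2, lintegral_zero] at h
  rw [lintegral_eq_zero_iff] at h
  · filter_upwards [h] with Y hY hk
    by_contra hne
    simp [hk, hne] at hY
  · exact (Measurable.of_discrete (f := fun p : S × S =>
      if exitRate q p.1 = 0 ∧ p.2 ≠ p.1 then (1 : ℝ≥0∞) else 0)).comp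
      ((measurable_pi_apply (X := fun _ : ℕ => S) k).prodMk (measurable_pi_apply (k + 1)))

/-- On a never absorbed path each mean holding time is at least the inverse of the sum of all exit
rates, so their sum diverges; finite expectation makes this a null event. -/
theorem ae_jumpChainLaw_exists_absorbed (q : S → S → ℝ≥0) (x : S)
    (hfin : ∑' k, ∫⁻ Y, meanHolding q (Y k) ∂(jumpChainLaw q x) ≠ ∞) :
    ∀ᵐ Y ∂(jumpChainLaw q x), ∃ k, exitRate q (Y k) = 0 := by
  have hm : ∀ k, Measurable fun Y : ℕ → S => meanHolding q (Y k) := 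
    measurable_comp_coord _
  rw [← lintegral_tsum fun k => (hm k).aemeasurable] at hfin
  filter_upwards [ae_lt_top (Measurable.tsum hm) hfin] with Y hY
  by_contra! hne
  refine hY.ne (top_unique ?_)
  have hε : ((∑ i, exitRate q i : ℝ≥0) : ℝ≥0∞)⁻¹ ≠ 0 := by simp
  rw [← ENNReal.tsum_const_eq_top_of_ne_zero (α := ℕ) hε]
  refine ENNReal.tsum_le_tsum fun k => ?_
  rw [meanHolding, if_neg (hne k)]
  gcongr
  exact Finset.single_le_sum (f := exitRate q) (fun i _ => zero_le) (Finset.mem_univ _)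

theorem ae_law_of_finite (q : S → S → ℝ≥0) (x : S)
    (hfin : ∑' k, ∫⁻ Y, meanHolding q (Y k) ∂(jumpChainLaw q x) ≠ ∞) :
    ∀ᵐ ω ∂(law q x),
      (∃ a, exitRate q a = 0 ∧ hittingTime q a ω ≤ activeTime q ω) ∧
      ∀ a, exitRate q a = 0 → activeTime q ω ≤ hittingTime q a ω := by
  have hE : ∀ᵐ E ∂(Measure.infinitePi fun _ : ℕ => expMeasure 1), ∀ k, 0 < E k := by
    rw [ae_all_iff]
    intro k
    have h := ae_pos_expMeasure_one
    rw [← Measure.infinitePi_map_eval (fun _ : ℕ => expMeasure 1) k] at h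
    exact ae_of_ae_map (measurable_pi_apply k).aemeasurable h
  have h1 : ∀ᵐ ω ∂(law q x), ∀ k, 0 < ω.2 k :=
    Measure.quasiMeasurePreserving_snd.ae hE
  have h2 : ∀ᵐ ω ∂(law q x), ∀ k, exitRate q (ω.1 k) = 0 → ω.1 (k + 1) = ω.1 k :=
    Measure.quasiMeasurePreserving_fst.ae (ae_jumpChainLaw_absorbed q x)
  have h3 : ∀ᵐ ω ∂(law q x), ∃ k, exitRate q (ω.1 k) = 0 :=
    Measure.quasiMeasurePreserving_fst.ae (ae_jumpChainLaw_exists_absorbed q x hfin)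
  filter_upwards [h1, h2, h3] with ω a b c using hittingTime_eq_activeTime b a c

end CTMC

namespace MajorityRule

/-! ### The binomial tail and monotonicity of `g_K` -/

theorem continuous_binTail (K : ℕ) : Continuous (binTail K) := by
  unfold binTail; fun_prop

theorem pow_le_binTail {K : ℕ} (hK : 1 ≤ K) {x : ℝ} (h0 : 0 ≤ x) (h1 : x ≤ 1) :
    x ^ (2 * K) ≤ binTail K x := by
  have h1' : 0 ≤ 1 - x := by linarith
  rw [binTail]
  exact le_trans (by simp) (Finset.single_le_sum
    (f := fun i => ((2 * K).choose i : ℝ) * x ^ i * (1 - x) ^ (2 * K - i))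
    (fun i _ => by positivity) (a := 2 * K) (Finset.mem_Icc.mpr ⟨by omega, le_rfl⟩))

theorem binTail_pos {K : ℕ} (hK : 1 ≤ K) {x : ℝ} (h0 : 0 < x) (h1 : x ≤ 1) :
    0 < binTail K x :=
  (pow_pos h0 _).trans_le (pow_le_binTail hK h0.le h1)

theorem binTail_zero (K : ℕ) : binTail K 0 = 0 :=
  Finset.sum_eq_zero fun i hi => by
    rw [Finset.mem_Icc] at hi
    rw [zero_pow (by omega)]; ring

theorem binTail_nonneg {K : ℕ} {x : ℝ} (h0 : 0 ≤ x) (h1 : x ≤ 1) : 0 ≤ binTail K x := by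
  have h1' : 0 ≤ 1 - x := by linarith
  exact Finset.sum_nonneg fun i _ => by positivity

theorem binTail_le_one {K : ℕ} {x : ℝ} (h0 : 0 ≤ x) (h1 : x ≤ 1) : binTail K x ≤ 1 := by
  have h1' : 0 ≤ 1 - x := by linarith
  have h := add_pow x (1 - x) (2 * K)
  rw [add_sub_cancel, one_pow] at h
  rw [h, binTail]
  refine (Finset.sum_le_sum_of_subset_of_nonneg (t := Finset.range (2 * K + 1)) ?_ ?_).trans
    (Finset.sum_le_sum fun i _ => le_of_eq (by ring))
  · intro i hi
    simp only [Finset.mem_Icc, Finset.mem_range] at hi ⊢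
    omega
  · intro i _ _
    positivity

/-- The inequality holds term by term. Since `i, j ≥ K + 1`, `e = i + j - 2K - 2` is a natural
number; the terms share a common factor, leaving `(x(1 - y))^e ≤ (y(1 - x))^e`. -/
theorem binTail_mul_le {K : ℕ} {x y : ℝ} (hx : 0 ≤ x) (hxy : x ≤ y) (hy : y ≤ 1) :
    binTail K x * binTail K (1 - y) * ((1 - x) ^ 2 * y ^ 2) ≤
      binTail K y * binTail K (1 - x) * ((1 - y) ^ 2 * x ^ 2) := by
  have hx' : 0 ≤ 1 - x := by linarith
  have hy' : 0 ≤ 1 - y := by linarith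
  have hy0 : 0 ≤ y := by linarith
  simp only [binTail, Finset.sum_mul_sum, sub_sub_cancel]
  simp only [Finset.sum_mul]
  refine Finset.sum_le_sum fun i hi => Finset.sum_le_sum fun j hj => ?_
  rw [Finset.mem_Icc] at hi hj
  obtain ⟨a, ha⟩ := Nat.exists_eq_add_of_le hi.2
  obtain ⟨b, hb⟩ := Nat.exists_eq_add_of_le hj.2
  obtain ⟨e, he⟩ := Nat.exists_eq_add_of_le (show 2 * K + 2 ≤ i + j by omega)
  have hi' : 2 * K - i = a := by omega
  have hj' : 2 * K - j = b := by omega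
  have hie : i = b + 2 + e := by omega
  have hje : j = a + 2 + e := by omega
  rw [hi', hj', hie, hje]
  have key : (x * (1 - y)) ^ e ≤ (y * (1 - x)) ^ e := by gcongr
  calc _ = ((2 * K).choose (b + 2 + e) * (2 * K).choose (a + 2 + e) *
        (x ^ (b + 2) * (1 - x) ^ (a + 2) * (1 - y) ^ (a + 2) * y ^ (b + 2))) *
        (x * (1 - y)) ^ e := by rw [mul_pow]; ring
    _ ≤ ((2 * K).choose (b + 2 + e) * (2 * K).choose (a + 2 + e) *
        (x ^ (b + 2) * (1 - x) ^ (a + 2) * (1 - y) ^ (a + 2) * y ^ (b + 2))) *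
        (y * (1 - x)) ^ e := by gcongr
    _ = _ := by rw [mul_pow]; ring

theorem gK_eq (K : ℕ) (x : ℝ) :
    gK K x = ((1 - x) * binTail K x) / (x * binTail K (1 - x)) := by
  rw [gK, one_div_mul_eq_div, one_div_mul_eq_div, div_div_div_eq, mul_comm (binTail K x)]

theorem gK_pos {K : ℕ} (hK : 1 ≤ K) {x : ℝ} (hx : x ∈ Ioo (0 : ℝ) 1) : 0 < gK K x := by
  have h1 := binTail_pos hK hx.1 hx.2.le
  have h2 := binTail_pos hK (x := 1 - x) (by linarith [hx.2]) (by linarith [hx.1])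
  have h3 : 0 < 1 - x := by linarith [hx.2]
  have h4 := hx.1
  rw [gK_eq]
  positivity

/-- The odds-normalized ratio `g_K(x) (1 - x) / x` is nondecreasing. -/
theorem gK_mul_le {K : ℕ} (hK : 1 ≤ K) {x y : ℝ} (hx : x ∈ Ioo (0 : ℝ) 1)
    (hy : y ∈ Ioo (0 : ℝ) 1) (hxy : x ≤ y) :
    gK K x * ((1 - x) * y) ≤ gK K y * (x * (1 - y)) := by
  have h2 := binTail_pos hK (x := 1 - x) (by linarith [hx.2]) (by linarith [hx.1])
  have h2' := binTail_pos hK (x := 1 - y) (by linarith [hy.2]) (by linarith [hy.1])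
  have h4 := hx.1
  have h4' := hy.1
  rw [gK_eq, gK_eq, div_mul_eq_mul_div, div_mul_eq_mul_div, div_le_div_iff₀ (by positivity)
    (by positivity)]
  have := binTail_mul_le (K := K) hx.1.le hxy hy.2.le
  nlinarith [this]

theorem gK_half {K : ℕ} (hK : 1 ≤ K) : gK K (1 / 2) = 1 := by
  have h := binTail_pos hK (x := 1 / 2) (by norm_num) (by norm_num)
  rw [gK_eq, show (1 : ℝ) - 1 / 2 = 1 / 2 by norm_num]
  exact div_self (by positivity)

/-- Quantitative monotonicity: with `y` or `x` equal to `β`, this is the linear lower bound on the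
drift. -/
theorem one_sub_div_gK_ge {K : ℕ} (hK : 1 ≤ K) {x y : ℝ} (hx : x ∈ Ioo (0 : ℝ) 1)
    (hy : y ∈ Ioo (0 : ℝ) 1) (hxy : x ≤ y) : y - x ≤ 1 - gK K x / gK K y := by
  have h := gK_mul_le hK hx hy hxy
  have hgy := gK_pos hK hy
  have h4 := hx.1
  have h4' := hy.1
  have h5 : 0 < 1 - x := by linarith [hx.2]
  have h1 : gK K x / gK K y ≤ x * (1 - y) / ((1 - x) * y) := by
    rw [div_le_div_iff₀ hgy (by positivity)]
    linarith
  have h2 : x * (1 - y) / ((1 - x) * y) = 1 - (y - x) / ((1 - x) * y) := by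
    field_simp; ring
  have h3 : y - x ≤ (y - x) / ((1 - x) * y) := by
    rw [le_div_iff₀ (by positivity)]
    have : (1 - x) * y ≤ 1 := by nlinarith [hx.2, hy.2]
    nlinarith
  linarith

theorem gK_strictMonoOn {K : ℕ} (hK : 1 ≤ K) : StrictMonoOn (gK K) (Ioo 0 1) := by
  intro x hx y hy hxy
  have := one_sub_div_gK_ge hK hx hy hxy.le
  rw [← div_lt_one (gK_pos hK hy)]
  linarith

theorem existsUnique_gK_eq {K : ℕ} (hK : 1 ≤ K) {θ : ℝ} (h0 : 0 < θ) (h1 : θ < 1) :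
    ∃! β : ℝ, β ∈ Ioo (0 : ℝ) 1 ∧ gK K β = θ := by
  -- Comparison with `1/2`, where `g_K = 1`, gives `g_K(x) ≤ x/(1 - x)` for `x ≤ 1/2`; the right
  -- side equals `θ` at `x = θ/(1 + θ)`.
  have hz : θ / (1 + θ) ∈ Ioo (0 : ℝ) 1 :=
    ⟨by positivity, by rw [div_lt_one (by positivity)]; linarith⟩
  have hh : (1 / 2 : ℝ) ∈ Ioo (0 : ℝ) 1 := by norm_num
  have hle : θ / (1 + θ) ≤ 1 / 2 := by rw [div_le_div_iff₀ (by positivity) (by norm_num)]; linarith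
  have hlow : gK K (θ / (1 + θ)) ≤ θ := by
    have h := gK_mul_le hK hz hh hle
    rw [gK_half hK] at h
    have e : 1 - θ / (1 + θ) = 1 / (1 + θ) := by field_simp; ring
    rw [e] at h
    field_simp at h
    linarith
  have hc : ContinuousOn (gK K) (Icc (θ / (1 + θ)) (1 / 2)) := by
    rw [funext (gK_eq K)]
    refine ContinuousOn.div ?_ ?_ ?_
    · exact ((continuous_const.sub continuous_id).mul (continuous_binTail K)).continuousOn
    · exact (continuous_id.mul ((continuous_binTail K).comp
        (continuous_const.sub continuous_id))).continuousOn
    · intro x hx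
      have hx0 : 0 < x := hz.1.trans_le hx.1
      have := binTail_pos hK (x := 1 - x) (by linarith [hx.2]) (by linarith)
      positivity
  obtain ⟨β, hβ, hgβ⟩ := intermediate_value_Icc hle hc ⟨hlow, by rw [gK_half hK]; exact h1.le⟩
  have hβ' : β ∈ Ioo (0 : ℝ) 1 := ⟨hz.1.trans_le hβ.1, by linarith [hβ.2]⟩
  exact ⟨β, ⟨hβ', hgβ⟩, fun γ hγ => (gK_strictMonoOn hK).injOn hγ.1 hβ' (hγ.2.trans hgβ.symm)⟩

/-- The real-valued harmonic numbers. -/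
noncomputable def harm (n : ℕ) : ℝ := ∑ k ∈ Finset.Icc 1 n, (k : ℝ)⁻¹

/-! ### Harmonic numbers -/

theorem harm_eq (n : ℕ) : harm n = harmonic n := by
  rw [harm, harmonic_eq_sum_Icc]; push_cast; rfl

theorem harm_succ (n : ℕ) : harm (n + 1) = harm n + ((n : ℝ) + 1)⁻¹ := by
  rw [harm, Finset.sum_Icc_succ_top (by omega), harm]; push_cast; rfl

theorem harm_zero : harm 0 = 0 := by simp [harm]

theorem log_add_one_le_harm (n : ℕ) : Real.log (n + 1) ≤ harm n := by
  rw [harm_eq]; exact_mod_cast log_add_one_le_harmonic n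

theorem harm_le_one_add_log (n : ℕ) : harm n ≤ 1 + Real.log n := by
  rw [harm_eq]; exact harmonic_le_one_add_log n

/-- Harmonic increments decrease. This makes the potential of the lower bound nonnegative. -/
theorem harm_add_le (m n : ℕ) : harm (m + n) ≤ harm m + harm n := by
  induction n with
  | zero => simp [harm_zero]
  | succ n ih =>
    rw [← add_assoc, harm_succ, harm_succ]
    have : (((m + n : ℕ) : ℝ) + 1)⁻¹ ≤ ((n : ℝ) + 1)⁻¹ := by
      gcongr; omega
    linarith

theorem harm_mono : Monotone harm := fun _ _ h =>
  Finset.sum_le_sum_of_subset_of_nonneg (Finset.Icc_subset_Icc_right h) fun _ _ _ => by positivity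

/-! ### Potentials for birth-death chains -/

/-- Partial fractions, with the reflection `j ↦ M + 1 - j`. -/
theorem sum_inv_mul_inv_eq (M : ℕ) :
    ∑ j ∈ Finset.Icc 1 M, (j : ℝ)⁻¹ * ((M : ℝ) + 1 - j)⁻¹ = 2 * harm M / (M + 1) := by
  have hrefl : ∑ j ∈ Finset.Icc 1 M, ((M : ℝ) + 1 - j)⁻¹ = harm M := by
    rw [harm]
    refine Finset.sum_nbij' (fun j => M + 1 - j) (fun j => M + 1 - j) ?_ ?_ ?_ ?_ ?_ <;>
      intro j hj <;> rw [Finset.mem_Icc] at hj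
    · rw [Finset.mem_Icc]; omega
    · rw [Finset.mem_Icc]; omega
    · omega
    · omega
    · rw [Nat.cast_sub (by omega)]; push_cast; rfl
  rw [two_mul, add_div]
  nth_rewrite 2 [← hrefl]
  rw [harm, Finset.sum_div, Finset.sum_div, ← Finset.sum_add_distrib]
  refine Finset.sum_congr rfl fun j hj => ?_
  rw [Finset.mem_Icc] at hj
  have h1 : (0 : ℝ) < j := by exact_mod_cast hj.1
  have h2 : (0 : ℝ) < (M : ℝ) + 1 - j := by
    have : (j : ℝ) ≤ M := by exact_mod_cast hj.2
    linarith
  field_simp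
  ring

/-- Sums of products of the ratios of a birth-death chain that contracts at a linear rate. -/
theorem sum_prod_le {M : ℕ} {L : ℝ} (hL : M ≤ L) {r : ℕ → ℝ}
    (hr : ∀ n ∈ Finset.Icc 1 M, 0 ≤ r n ∧ r n ≤ 1 - (M - n) / L) {j : ℕ} (hj1 : 1 ≤ j)
    (hjM : j ≤ M) :
    ∑ n ∈ Finset.Icc 1 j, ∏ i ∈ Finset.Ico n j, r i ≤ L * ((M : ℝ) + 1 - j)⁻¹ := by
  induction j, hj1 using Nat.le_induction with
  | base =>
    have : (0 : ℝ) < M := by exact_mod_cast hjM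
    simp only [Finset.Icc_self, Finset.sum_singleton, Finset.Ico_self, Finset.prod_empty,
      Nat.cast_one, add_sub_cancel_right]
    rw [← div_eq_mul_inv, one_le_div this]
    exact hL
  | succ j hj1 ih =>
    have hih := ih (by omega)
    have hM : (j : ℝ) + 1 ≤ M := by exact_mod_cast hjM
    have hL0 : 0 < L := by
      have : (0 : ℝ) ≤ j := Nat.cast_nonneg j
      linarith
    obtain ⟨h0, h1⟩ := hr j (Finset.mem_Icc.mpr ⟨hj1, by omega⟩)
    have hrec : ∑ n ∈ Finset.Icc 1 (j + 1), ∏ i ∈ Finset.Ico n (j + 1), r i =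
        1 + r j * ∑ n ∈ Finset.Icc 1 j, ∏ i ∈ Finset.Ico n j, r i := by
      rw [Finset.sum_Icc_succ_top (by omega), Finset.Ico_self, Finset.prod_empty, add_comm,
        Finset.mul_sum]
      congr 1
      refine Finset.sum_congr rfl fun n hn => ?_
      rw [Finset.mem_Icc] at hn
      rw [Finset.prod_Ico_succ_top hn.2, mul_comm]
    have hp : (0 : ℝ) < M - j := by linarith
    have hsum : ∑ n ∈ Finset.Icc 1 j, ∏ i ∈ Finset.Ico n j, r i ≤ L * ((M : ℝ) - j)⁻¹ := by
      refine hih.trans ?_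
      gcongr
      linarith
    have e : (M : ℝ) + 1 - ((j + 1 : ℕ) : ℝ) = M - j := by push_cast; ring
    rw [hrec, e]
    -- The bound `L / (M + 1 - j)` is exactly reproduced by the recursion `S (j + 1) = 1 + r j * S
    -- j` at the extreme value of `r j`.
    calc 1 + r j * ∑ n ∈ Finset.Icc 1 j, ∏ i ∈ Finset.Ico n j, r i
        ≤ 1 + r j * (L * ((M : ℝ) - j)⁻¹) := by gcongr
      _ ≤ 1 + (1 - (M - j) / L) * (L * ((M : ℝ) - j)⁻¹) := by gcongr
      _ = L * ((M : ℝ) - j)⁻¹ := by field_simp; ring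

/-- With `a = 1/v` and `r = u/v`, `d n` is the mean passage time from `n` to `n - 1` when the jump
up from `M` is suppressed. Iterating the recursion gives an explicit sum; summing over `n` first
allows `sum_prod_le`. -/
theorem exists_increments {M : ℕ} {L c : ℝ} (hL : M ≤ L) (hc : 0 < c) {a r : ℕ → ℝ}
    (ha : ∀ n ∈ Finset.Icc 1 M, 0 ≤ a n ∧ a n ≤ (c * n)⁻¹)
    (hr : ∀ n ∈ Finset.Icc 1 M, 0 ≤ r n ∧ r n ≤ 1 - (M - n) / L) :
    ∃ d : ℕ → ℝ, (∀ n, 1 ≤ n → 0 ≤ d n) ∧ (∀ n, M < n → d n = 0) ∧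
      (∀ n ∈ Finset.Icc 1 M, d n = a n + r n * d (n + 1)) ∧
      ∑ n ∈ Finset.Icc 1 M, d n ≤ 2 * L * harm M / (c * (M + 1)) := by
  refine ⟨fun n => ∑ j ∈ Finset.Icc n M, a j * ∏ i ∈ Finset.Ico n j, r i, ?_, ?_, ?_, ?_⟩
  · intro n hn
    refine Finset.sum_nonneg fun j hj => ?_
    rw [Finset.mem_Icc] at hj
    refine mul_nonneg (ha j (Finset.mem_Icc.mpr ⟨by omega, hj.2⟩)).1
      (Finset.prod_nonneg fun i hi => ?_)
    rw [Finset.mem_Ico] at hi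
    exact (hr i (Finset.mem_Icc.mpr ⟨by omega, by omega⟩)).1
  · intro n hn
    simp [Finset.Icc_eq_empty_of_lt hn]
  · intro n hn
    rw [Finset.mem_Icc] at hn
    beta_reduce
    rw [← Finset.add_sum_Ioc_eq_sum_Icc hn.2, Finset.Ico_self, Finset.prod_empty, mul_one,
      Finset.mul_sum]
    congr 1
    refine Finset.sum_congr (by ext; simp) fun j hj => ?_
    rw [Finset.mem_Icc] at hj
    rw [Finset.prod_eq_prod_Ico_succ_bot (by omega)]
    ring
  · rw [Finset.sum_comm' (t' := Finset.Icc 1 M) (s' := fun j => Finset.Icc 1 j)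
      (by intro x y; simp only [Finset.mem_Icc]; omega)]
    simp_rw [← Finset.mul_sum]
    calc _ ≤ ∑ j ∈ Finset.Icc 1 M, (c * j)⁻¹ * (L * ((M : ℝ) + 1 - j)⁻¹) := by
          refine Finset.sum_le_sum fun j hj => ?_
          have hj' := Finset.mem_Icc.mp hj
          obtain ⟨h0, h1⟩ := ha j hj
          exact mul_le_mul h1 (sum_prod_le hL hr hj'.1 hj'.2)
            (Finset.sum_nonneg fun n hn => Finset.prod_nonneg fun i hi => (hr i (by
              simp only [Finset.mem_Icc, Finset.mem_Ico] at *; omega)).1) (by positivity)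
      _ = L / c * ∑ j ∈ Finset.Icc 1 M, (j : ℝ)⁻¹ * ((M : ℝ) + 1 - j)⁻¹ := by
          rw [Finset.mul_sum]
          refine Finset.sum_congr rfl fun j _ => ?_
          rw [mul_inv]; ring
      _ = _ := by rw [sum_inv_mul_inv_eq]; field_simp

/-- A potential for birth-death rates `u` (up) and `v` (down) on `{0, …, N}` whose drift points
away from an intermediate site. -/
theorem exists_potential {N M : ℕ} (hM : M < N) {c : ℝ} (hc : 0 < c) {u v : ℕ → ℝ}
    (hv : ∀ n ∈ Finset.Icc 1 M, c * n ≤ v n ∧ 0 ≤ u n ∧ u n / v n ≤ 1 - (M - n) / N)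
    (hu : ∀ n ∈ Finset.Ioo M N, c * ((N : ℝ) - n) ≤ u n ∧ 0 ≤ v n ∧
      v n / u n ≤ 1 - ((n : ℝ) - (M + 1)) / N) :
    ∃ W : ℕ → ℝ, (∀ n, 0 ≤ W n) ∧
      (∀ n, 0 < n → n < N → 1 + (u n * W (n + 1) + v n * W (n - 1)) ≤ (u n + v n) * W n) ∧
      ∀ n ≤ N, W n ≤ 2 * N * harm M / (c * (M + 1)) + 2 * N * harm (N - M - 1) / (c * (N - M)) := by
  have hMN : (M : ℝ) ≤ N := by exact_mod_cast hM.le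
  have hpos : ∀ {n : ℕ}, 1 ≤ n → (0 : ℝ) < c * n := fun h => mul_pos hc (by exact_mod_cast h)
  obtain ⟨d, hd0, hdM, hd, hdsum⟩ := exists_increments (M := M) (L := N) (c := c)
    (a := fun n => (v n)⁻¹) (r := fun n => u n / v n) hMN hc
    (fun n hn => by
      have h1 := hpos (Finset.mem_Icc.mp hn).1
      have h2 := (hv n hn).1
      exact ⟨inv_nonneg.mpr (h1.le.trans h2), inv_anti₀ h1 h2⟩)
    (fun n hn => by
      have h1 := hpos (Finset.mem_Icc.mp hn).1
      obtain ⟨h2, h3, h4⟩ := hv n hn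
      exact ⟨div_nonneg h3 (h1.le.trans h2), h4⟩)
  have hM' : ((N - M - 1 : ℕ) : ℝ) = (N : ℝ) - M - 1 := by
    rw [Nat.sub_sub, Nat.cast_sub (by omega)]; push_cast; ring
  have hcast : ∀ n ∈ Finset.Icc 1 (N - M - 1), ((N - n : ℕ) : ℝ) = N - n := fun n hn =>
    Nat.cast_sub (by rw [Finset.mem_Icc] at hn; omega)
  have hmem : ∀ n ∈ Finset.Icc 1 (N - M - 1), N - n ∈ Finset.Ioo M N := fun n hn => by
    rw [Finset.mem_Icc] at hn; rw [Finset.mem_Ioo]; omega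
  have hu' : ∀ n ∈ Finset.Icc 1 (N - M - 1), c * n ≤ u (N - n) ∧ 0 ≤ v (N - n) ∧
      v (N - n) / u (N - n) ≤ 1 - ((N - M - 1 : ℕ) - n) / N := fun n hn => by
    obtain ⟨h1, h2, h3⟩ := hu _ (hmem n hn)
    rw [hcast n hn] at h1 h3
    refine ⟨by simpa using h1, h2, h3.trans_eq ?_⟩
    rw [hM']; ring
  -- The right side is the same problem after the reflection `n ↦ N - n`.
  obtain ⟨e, he0, heM, he, hesum⟩ := exists_increments (M := N - M - 1) (L := N) (c := c)
    (a := fun n => (u (N - n))⁻¹) (r := fun n => v (N - n) / u (N - n))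
    (by exact_mod_cast (by omega : N - M - 1 ≤ N)) hc
    (fun n hn => by
      have h1 := hpos (Finset.mem_Icc.mp hn).1
      have h2 := (hu' n hn).1
      exact ⟨inv_nonneg.mpr (h1.le.trans h2), inv_anti₀ h1 h2⟩)
    (fun n hn => by
      have h1 := hpos (Finset.mem_Icc.mp hn).1
      obtain ⟨h2, h3, h4⟩ := hu' n hn
      exact ⟨div_nonneg h3 (h1.le.trans h2), h4⟩)
  have hsum_le : ∀ {f : ℕ → ℝ} {m : ℕ}, (∀ n, 1 ≤ n → 0 ≤ f n) → (∀ n, m < n → f n = 0) →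
      ∀ n, ∑ k ∈ Finset.Icc 1 n, f k ≤ ∑ k ∈ Finset.Icc 1 m, f k := by
    intro f m h0 hm n
    rw [← Finset.sum_subset (s₁ := Finset.Icc 1 (min n m)) (s₂ := Finset.Icc 1 n)
      (Finset.Icc_subset_Icc_right (min_le_left _ _))]
    · exact Finset.sum_le_sum_of_subset_of_nonneg
        (Finset.Icc_subset_Icc_right (min_le_right _ _))
        fun k hk _ => h0 k (Finset.mem_Icc.mp hk).1
    · intro k hk hk'
      simp only [Finset.mem_Icc, le_min_iff] at hk hk'
      exact hm k (by omega)
  -- `W` rises by `d` up to `M`, is flat between `M` and `M + 1`, then falls by `e`. It need not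
  -- vanish at the ends, since a supersolution only has to be nonnegative.
  refine ⟨fun n => ∑ k ∈ Finset.Icc 1 n, d k + ∑ k ∈ Finset.Icc 1 (N - n), e k, ?_, ?_, ?_⟩
  · exact fun n => add_nonneg
      (Finset.sum_nonneg fun k hk => hd0 k (Finset.mem_Icc.mp hk).1)
      (Finset.sum_nonneg fun k hk => he0 k (Finset.mem_Icc.mp hk).1)
  · intro n hn0 hnN
    have s1 : ∑ k ∈ Finset.Icc 1 (n + 1), d k = ∑ k ∈ Finset.Icc 1 n, d k + d (n + 1) :=
      Finset.sum_Icc_succ_top (by omega) _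
    have s2 : ∑ k ∈ Finset.Icc 1 n, d k = ∑ k ∈ Finset.Icc 1 (n - 1), d k + d n := by
      obtain ⟨m, rfl⟩ := Nat.exists_eq_add_of_le' hn0
      exact Finset.sum_Icc_succ_top (by omega) _
    have s3 : ∑ k ∈ Finset.Icc 1 (N - (n - 1)), e k =
        ∑ k ∈ Finset.Icc 1 (N - n), e k + e (N - n + 1) := by
      rw [show N - (n - 1) = N - n + 1 by omega]
      exact Finset.sum_Icc_succ_top (by omega) _
    have s4 : ∑ k ∈ Finset.Icc 1 (N - n), e k =
        ∑ k ∈ Finset.Icc 1 (N - (n + 1)), e k + e (N - n) := by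
      obtain ⟨m, hm⟩ := Nat.exists_eq_add_of_lt hnN
      rw [show N - n = m + 1 by omega, show N - (n + 1) = m by omega]
      exact Finset.sum_Icc_succ_top (by omega) _
    beta_reduce
    rw [s1, s3, s4, s2]
    rcases le_or_gt n M with h | h
    · have hn := Finset.mem_Icc.mpr ⟨hn0, h⟩
      have hvn : 0 < v n := (hpos hn0).trans_le (hv n hn).1
      have h1 : v n * d n = 1 + u n * d (n + 1) := by
        rw [hd n hn]; field_simp
      rw [heM (N - n) (by omega), heM (N - n + 1) (by omega)]
      linarith
    · have hn : N - n ∈ Finset.Icc 1 (N - M - 1) := Finset.mem_Icc.mpr ⟨by omega, by omega⟩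
      have h2 := he _ hn
      have h3 := (hu' _ hn).1
      have h4 := hpos (Finset.mem_Icc.mp hn).1
      rw [show N - (N - n) = n by omega] at h2 h3
      have hun : 0 < u n := h4.trans_le h3
      have h1 : u n * e (N - n) = 1 + v n * e (N - n + 1) := by
        rw [h2]; field_simp
      rw [hdM n h, hdM (n + 1) (by omega)]
      linarith
  · intro n _
    refine add_le_add ((hsum_le hd0 hdM n).trans hdsum) ((hsum_le he0 heM _).trans ?_)
    rw [hM', sub_add_cancel] at hesum
    exact hesum

/-! ### Rates of the majority chain -/

theorem upRate_nonneg (K : ℕ) {q₀ : ℝ} (hq : 0 ≤ q₀) {N n : ℕ} (hn : n ≤ N) :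
    0 ≤ upRate K q₀ N n := by
  have h : (n : ℝ) ≤ N := by exact_mod_cast hn
  exact mul_nonneg (mul_nonneg (by linarith) hq)
    (binTail_nonneg (by positivity) (div_le_one_of_le₀ h (by positivity)))

theorem downRate_nonneg (K : ℕ) {q₁ : ℝ} (hq : 0 ≤ q₁) {N n : ℕ} (hn : n ≤ N) :
    0 ≤ downRate K q₁ N n := by
  have h : (n : ℝ) ≤ N := by exact_mod_cast hn
  have h1 := div_le_one_of_le₀ h (by positivity)
  exact mul_nonneg (mul_nonneg (by positivity) hq)
    (binTail_nonneg (by linarith) (by linarith [show (0 : ℝ) ≤ n / N by positivity]))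

theorem upRate_le (K : ℕ) {q₀ : ℝ} (hq : q₀ ∈ Ioo (0 : ℝ) 1) {N n : ℕ} (hn : n ≤ N) :
    upRate K q₀ N n ≤ N - n := by
  have h : (n : ℝ) ≤ N := by exact_mod_cast hn
  have hB := binTail_le_one (K := K) (x := n / N) (by positivity)
    (div_le_one_of_le₀ h (by positivity))
  have hB0 := binTail_nonneg (K := K) (x := n / N) (by positivity)
    (div_le_one_of_le₀ h (by positivity))
  rw [upRate, mul_assoc]
  exact mul_le_of_le_one_right (by linarith) (mul_le_one₀ hq.2.le hB0 hB)

theorem downRate_le (K : ℕ) {q₁ : ℝ} (hq : q₁ ∈ Ioo (0 : ℝ) 1) {N n : ℕ} (hn : n ≤ N) :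
    downRate K q₁ N n ≤ n := by
  have h : (n : ℝ) ≤ N := by exact_mod_cast hn
  have h1 := div_le_one_of_le₀ h (by positivity)
  have h0 : (0 : ℝ) ≤ n / N := by positivity
  have hB := binTail_le_one (K := K) (x := 1 - n / N) (by linarith) (by linarith)
  have hB0 := binTail_nonneg (K := K) (x := 1 - n / N) (by linarith) (by linarith)
  rw [downRate, mul_assoc]
  exact mul_le_of_le_one_right (by positivity) (mul_le_one₀ hq.2.le hB0 hB)

theorem pow_mul_le_upRate {K : ℕ} (hK : 1 ≤ K) {q₀ : ℝ} (hq : 0 ≤ q₀) {N n : ℕ} (hn : n ≤ N) :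
    q₀ * ((n : ℝ) / N) ^ (2 * K) * (N - n) ≤ upRate K q₀ N n := by
  have h : (n : ℝ) ≤ N := by exact_mod_cast hn
  have := pow_le_binTail hK (x := n / N) (by positivity) (div_le_one_of_le₀ h (by positivity))
  have h0 : (0 : ℝ) ≤ (N - n) * q₀ := mul_nonneg (by linarith) hq
  rw [upRate]
  nlinarith [mul_le_mul_of_nonneg_left this h0]

theorem pow_mul_le_downRate {K : ℕ} (hK : 1 ≤ K) {q₁ : ℝ} (hq : 0 ≤ q₁) {N n : ℕ} (hn : n ≤ N) :
    q₁ * (1 - (n : ℝ) / N) ^ (2 * K) * n ≤ downRate K q₁ N n := by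
  have h : (n : ℝ) ≤ N := by exact_mod_cast hn
  have h1 := div_le_one_of_le₀ h (by positivity)
  have := pow_le_binTail hK (x := 1 - n / N) (by linarith)
    (by linarith [show (0 : ℝ) ≤ n / N by positivity])
  have h0 : (0 : ℝ) ≤ n * q₁ := by positivity
  rw [downRate]
  nlinarith [mul_le_mul_of_nonneg_left this h0]

theorem upRate_pos {K : ℕ} (hK : 1 ≤ K) {q₀ : ℝ} (hq : 0 < q₀) {N n : ℕ} (h0 : 0 < n)
    (hn : n < N) : 0 < upRate K q₀ N n := by
  have h1 : (0 : ℝ) < n := by exact_mod_cast h0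
  have h2 : (0 : ℝ) < N := h1.trans (by exact_mod_cast hn)
  have h3 : (0 : ℝ) < N - n := sub_pos.mpr (by exact_mod_cast hn)
  exact (by positivity : 0 < q₀ * ((n : ℝ) / N) ^ (2 * K) * (N - n)).trans_le
    (pow_mul_le_upRate hK hq.le hn.le)

/-- When `g_K(β) = q₁/q₀`, the ratio is `g_K(n/N)/g_K(β)`, so the drift changes sign at `β`. -/
theorem upRate_div_downRate {K N n : ℕ} (q₀ q₁ : ℝ) (h0 : 0 < n) (hn : n < N) :
    upRate K q₀ N n / downRate K q₁ N n = gK K (n / N) / (q₁ / q₀) := by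
  have h2 : (0 : ℝ) < N := by exact_mod_cast h0.trans hn
  have e : (N : ℝ) - n = N * (1 - n / N) := by field_simp
  have e' : (n : ℝ) = N * (n / N) := by field_simp
  rw [gK_eq, div_div_div_eq, upRate, downRate, e]
  nth_rewrite 3 [e']
  rw [show N * (1 - (n : ℝ) / N) * q₀ * binTail K (n / N) =
      N * ((1 - (n : ℝ) / N) * binTail K (n / N) * q₀) by ring,
    show N * ((n : ℝ) / N) * q₁ * binTail K (1 - n / N) =
      N * ((n : ℝ) / N * binTail K (1 - n / N) * q₁) by ring, mul_div_mul_left _ _ h2.ne']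

theorem sum_offDiag_rate_mul (K : ℕ) (q₀ q₁ : ℝ) {N n : ℕ} (h0 : 0 < n) (hn : n < N)
    (f : ℕ → ℝ≥0∞) :
    ∑ j : Fin (N + 1), (CTMC.offDiag (rate K q₀ q₁ N) ⟨n, by omega⟩ j : ℝ≥0∞) * f j =
      ENNReal.ofReal (upRate K q₀ N n) * f (n + 1) +
        ENNReal.ofReal (downRate K q₁ N n) * f (n - 1) := by
  rw [Finset.sum_eq_add (⟨n + 1, by omega⟩ : Fin (N + 1)) (⟨n - 1, by omega⟩ : Fin (N + 1))]
  · have h1 : CTMC.offDiag (rate K q₀ q₁ N) ⟨n, by omega⟩ ⟨n + 1, by omega⟩ =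
        (upRate K q₀ N n).toNNReal := by
      simp [CTMC.offDiag, rate]
    have h2 : CTMC.offDiag (rate K q₀ q₁ N) ⟨n, by omega⟩ ⟨n - 1, by omega⟩ =
        (downRate K q₁ N n).toNNReal := by
      rw [CTMC.offDiag, if_neg (by simp; omega), rate, if_neg (by simp only; omega),
        if_pos (by simp; omega)]
    rw [h1, h2]
    rfl
  · simp; omega
  · intro j _ hj
    simp only [ne_eq, Fin.ext_iff] at hj
    rw [CTMC.offDiag, rate, if_neg (c := (j : ℕ) = _) (by simp; omega),
      if_neg (c := (j : ℕ) + 1 = _) (by simp; omega)]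
    simp
  · simp
  · simp

theorem exitRate_rate (K : ℕ) (q₀ q₁ : ℝ) {N n : ℕ} (h0 : 0 < n) (hn : n < N) :
    (CTMC.exitRate (rate K q₀ q₁ N) ⟨n, by omega⟩ : ℝ≥0∞) =
      ENNReal.ofReal (upRate K q₀ N n) + ENNReal.ofReal (downRate K q₁ N n) := by
  have := sum_offDiag_rate_mul K q₀ q₁ h0 hn 1
  simp only [Pi.one_apply, mul_one] at this
  rw [← this, ← CTMC.tsum_offDiag, tsum_fintype]

theorem exitRate_rate_eq_zero_iff {K : ℕ} (hK : 1 ≤ K) {q₀ : ℝ} (hq₀ : 0 < q₀) (q₁ : ℝ) {N : ℕ}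
    (i : Fin (N + 1)) :
    CTMC.exitRate (rate K q₀ q₁ N) i = 0 ↔ i = 0 ∨ i = Fin.last N := by
  constructor
  · intro h
    by_contra! hne
    have h0 : 0 < (i : ℕ) := Nat.pos_of_ne_zero fun h => hne.1 (Fin.ext h)
    have hN : (i : ℕ) < N := lt_of_le_of_ne (Nat.lt_succ_iff.mp i.2) fun h => hne.2 (Fin.ext h)
    have := exitRate_rate K q₀ q₁ h0 hN
    rw [Fin.eta, h, ENNReal.coe_zero, eq_comm, add_eq_zero] at this
    exact (ENNReal.ofReal_pos.mpr (upRate_pos hK hq₀ h0 hN)).ne' this.1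
  · intro h
    rw [CTMC.exitRate, Finset.sum_eq_zero_iff]
    intro j _
    rw [CTMC.offDiag, rate]
    have hj := j.2
    rcases h with rfl | rfl
    · simp [upRate, binTail_zero]
    · rw [if_neg (c := (j : ℕ) = _) (by simp; omega)]
      rcases Nat.eq_zero_or_pos N with rfl | hN
      · simp
      · have : (N : ℝ) ≠ 0 := by positivity
        simp [downRate, binTail_zero, this]

theorem eq_of_exitRate_ne_zero {K : ℕ} (hK : 1 ≤ K) {q₀ : ℝ} (hq₀ : 0 < q₀) {q₁ : ℝ} {N : ℕ}
    {i : Fin (N + 1)} (h : CTMC.exitRate (rate K q₀ q₁ N) i ≠ 0) :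
    0 < (i : ℕ) ∧ (i : ℕ) < N := by
  rw [ne_eq, exitRate_rate_eq_zero_iff hK hq₀, not_or] at h
  exact ⟨Nat.pos_of_ne_zero fun h' => h.1 (Fin.ext h'),
    lt_of_le_of_ne (Nat.lt_succ_iff.mp i.2) fun h' => h.2 (Fin.ext h')⟩

/-! ### Bounds on the mean consensus time -/

theorem meanConsensusTime_eq {K : ℕ} (hK : 1 ≤ K) {q₀ : ℝ} (hq₀ : 0 < q₀) (q₁ : ℝ) {N : ℕ}
    (x : Fin (N + 1))
    (hfin : ∑' k, ∫⁻ Y, CTMC.meanHolding (rate K q₀ q₁ N) (Y k)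
      ∂(CTMC.jumpChainLaw (rate K q₀ q₁ N) x) ≠ ∞) :
    meanConsensusTime K q₀ q₁ N x = ∑' k, ∫⁻ Y, CTMC.meanHolding (rate K q₀ q₁ N) (Y k)
      ∂(CTMC.jumpChainLaw (rate K q₀ q₁ N) x) := by
  rw [← CTMC.lintegral_activeTime, meanConsensusTime]
  refine lintegral_congr_ae ?_
  filter_upwards [CTMC.ae_law_of_finite _ x hfin] with ω hω
  obtain ⟨⟨a, ha, hle⟩, hge⟩ := hω
  refine le_antisymm ?_ (le_min (hge _ ?_) (hge _ ?_))
  · rcases (exitRate_rate_eq_zero_iff hK hq₀ q₁ a).mp ha with rfl | rfl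
    · exact (min_le_left _ _).trans hle
    · exact (min_le_right _ _).trans hle
  · exact (exitRate_rate_eq_zero_iff hK hq₀ q₁ _).mpr (Or.inl rfl)
  · exact (exitRate_rate_eq_zero_iff hK hq₀ q₁ _).mpr (Or.inr rfl)

theorem tsum_meanHolding_le_ofReal {K : ℕ} (hK : 1 ≤ K) {q₀ q₁ : ℝ} (hq₀ : 0 < q₀) (hq₁ : 0 < q₁)
    {N : ℕ} {W : ℕ → ℝ} (hW0 : ∀ n, 0 ≤ W n)
    (hW : ∀ n, 0 < n → n < N → 1 + (upRate K q₀ N n * W (n + 1) + downRate K q₁ N n * W (n - 1)) ≤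
      (upRate K q₀ N n + downRate K q₁ N n) * W n) (x : Fin (N + 1)) :
    ∑' k, ∫⁻ Y, CTMC.meanHolding (rate K q₀ q₁ N) (Y k)
      ∂(CTMC.jumpChainLaw (rate K q₀ q₁ N) x) ≤ ENNReal.ofReal (W x) := by
  refine CTMC.tsum_meanHolding_le (V := fun i : Fin (N + 1) => ENNReal.ofReal (W i)) (fun i => ?_) x
  refine CTMC.meanHolding_add_jumpOp_le fun hi => ?_
  obtain ⟨h0, hN⟩ := eq_of_exitRate_ne_zero hK hq₀ hi
  have hu := upRate_nonneg K hq₀.le hN.le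
  have hv := downRate_nonneg K hq₁.le hN.le
  have h1 := sum_offDiag_rate_mul K q₀ q₁ h0 hN (fun n => ENNReal.ofReal (W n))
  have h2 := exitRate_rate K q₀ q₁ h0 hN
  rw [Fin.eta] at h1 h2
  rw [h1, h2, ← ENNReal.ofReal_mul hu, ← ENNReal.ofReal_mul hv, ← ENNReal.ofReal_add hu hv,
    ← ENNReal.ofReal_mul (add_nonneg hu hv), ← ENNReal.ofReal_add (mul_nonneg hu (hW0 _))
    (mul_nonneg hv (hW0 _)), ← ENNReal.ofReal_one, ← ENNReal.ofReal_add zero_le_one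
    (add_nonneg (mul_nonneg hu (hW0 _)) (mul_nonneg hv (hW0 _)))]
  exact ENNReal.ofReal_le_ofReal (hW _ h0 hN)

theorem ofReal_le_tsum_meanHolding {K : ℕ} (hK : 1 ≤ K) {q₀ q₁ : ℝ} (hq₀ : 0 < q₀) (hq₁ : 0 < q₁)
    {N : ℕ} {W : ℕ → ℝ} (hW0 : ∀ n ≤ N, 0 ≤ W n) (hWl : W 0 = 0) (hWr : W N = 0)
    (hW : ∀ n, 0 < n → n < N → (upRate K q₀ N n + downRate K q₁ N n) * W n ≤
      1 + (upRate K q₀ N n * W (n + 1) + downRate K q₁ N n * W (n - 1))) (x : Fin (N + 1))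
    (hfin : ∑' k, ∫⁻ Y, CTMC.meanHolding (rate K q₀ q₁ N) (Y k)
      ∂(CTMC.jumpChainLaw (rate K q₀ q₁ N) x) ≠ ∞) :
    ENNReal.ofReal (W x) ≤ ∑' k, ∫⁻ Y, CTMC.meanHolding (rate K q₀ q₁ N) (Y k)
      ∂(CTMC.jumpChainLaw (rate K q₀ q₁ N) x) := by
  let V : Fin (N + 1) → ℝ≥0∞ := fun i => ENNReal.ofReal (W i)
  refine CTMC.le_tsum_meanHolding (V := V)
    (M := ∑ i, V i * CTMC.exitRate (rate K q₀ q₁ N) i) ?_ (fun i => ?_) (fun i => ?_) x hfin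
  · exact ENNReal.sum_ne_top.mpr fun i _ => ENNReal.mul_ne_top ENNReal.ofReal_ne_top
      ENNReal.coe_ne_top
  · refine CTMC.le_meanHolding_add_jumpOp fun hi => ?_
    obtain ⟨h0, hN⟩ := eq_of_exitRate_ne_zero hK hq₀ hi
    have hu := upRate_nonneg K hq₀.le hN.le
    have hv := downRate_nonneg K hq₁.le hN.le
    have h1 := sum_offDiag_rate_mul K q₀ q₁ h0 hN (fun n => ENNReal.ofReal (W n))
    have h2 := exitRate_rate K q₀ q₁ h0 hN
    rw [Fin.eta] at h1 h2
    have w1 := hW0 ((i : ℕ) + 1) hN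
    have w2 := hW0 ((i : ℕ) - 1) (by omega)
    rw [h1, h2, ← ENNReal.ofReal_mul hu, ← ENNReal.ofReal_mul hv, ← ENNReal.ofReal_add hu hv,
      ← ENNReal.ofReal_mul (add_nonneg hu hv), ← ENNReal.ofReal_add (mul_nonneg hu w1)
      (mul_nonneg hv w2), ← ENNReal.ofReal_one, ← ENNReal.ofReal_add zero_le_one
      (add_nonneg (mul_nonneg hu w1) (mul_nonneg hv w2))]
    exact ENNReal.ofReal_le_ofReal (hW _ h0 hN)
  · by_cases hi : CTMC.exitRate (rate K q₀ q₁ N) i = 0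
    · have : V i = 0 := by
        rcases (exitRate_rate_eq_zero_iff hK hq₀ q₁ i).mp hi with rfl | rfl
        · simp [V, hWl]
        · simp [V, hWr]
      rw [this]; exact zero_le
    · have h0 : (CTMC.exitRate (rate K q₀ q₁ N) i : ℝ≥0∞) ≠ 0 := by simpa using hi
      calc V i = V i * CTMC.exitRate (rate K q₀ q₁ N) i *
            CTMC.meanHolding (rate K q₀ q₁ N) i := by
            rw [CTMC.meanHolding, if_neg hi, mul_assoc,
              ENNReal.mul_inv_cancel h0 ENNReal.coe_ne_top, mul_one]
        _ ≤ _ := by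
            gcongr
            exact Finset.single_le_sum (f := fun i => V i * CTMC.exitRate (rate K q₀ q₁ N) i)
              (fun _ _ => zero_le) (Finset.mem_univ i)

/-- From every initial state, the mean time spent before consensus is at most a constant multiple
of the harmonic number of the population size. -/
theorem exists_tsum_meanHolding_le {K : ℕ} (hK : 1 ≤ K) {q₀ q₁ : ℝ} (hq₀ : 0 < q₀) (hq₁ : 0 < q₁)
    {β : ℝ} (hβ : β ∈ Ioo (0 : ℝ) 1) (hg : gK K β = q₁ / q₀) :
    ∃ C : ℝ, 0 < C ∧ ∀ (N : ℕ) (x : Fin (N + 1)),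
      ∑' k, ∫⁻ Y, CTMC.meanHolding (rate K q₀ q₁ N) (Y k)
        ∂(CTMC.jumpChainLaw (rate K q₀ q₁ N) x) ≤ ENNReal.ofReal (C * harm N) := by
  have hβ0 := hβ.1
  have hβ1 : 0 < 1 - β := sub_pos.mpr hβ.2
  -- Left of `β` the down rate per agent is at least `q₁(1 - β)^(2K)`; right of it the up rate per
  -- agent is at least `q₀β^(2K)`.
  obtain ⟨c, hc, hc1, hc0⟩ : ∃ c, 0 < c ∧ c ≤ q₁ * (1 - β) ^ (2 * K) ∧ c ≤ q₀ * β ^ (2 * K) :=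
    ⟨min (q₁ * (1 - β) ^ (2 * K)) (q₀ * β ^ (2 * K)), lt_min (by positivity) (by positivity),
      min_le_left _ _, min_le_right _ _⟩
  refine ⟨2 / (c * β) + 2 / (c * (1 - β)), by positivity, fun N x => ?_⟩
  rcases Nat.eq_zero_or_pos N with rfl | hN
  · refine (tsum_meanHolding_le_ofReal hK hq₀ hq₁ (W := fun _ => 0) (fun _ => le_rfl)
      (fun n h1 h2 => by omega) x).trans ?_
    simp
  have hN0 : (0 : ℝ) < N := by exact_mod_cast hN
  obtain ⟨M, hM1, hM2⟩ : ∃ M : ℕ, (M : ℝ) ≤ β * N ∧ β * N < M + 1 :=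
    ⟨⌊β * N⌋₊, Nat.floor_le (by positivity), Nat.lt_floor_add_one _⟩
  have hMN : M < N := by
    have : (M : ℝ) < N := hM1.trans_lt (by nlinarith [hβ.2])
    exact_mod_cast this
  have hfrac : ∀ {n : ℕ}, 0 < n → n < N → (n : ℝ) / N ∈ Ioo (0 : ℝ) 1 := fun {n} h0 h1 =>
    ⟨by positivity, (div_lt_one hN0).mpr (by exact_mod_cast h1)⟩
  obtain ⟨W, hW0, hW, hWle⟩ := exists_potential hMN hc (u := upRate K q₀ N)
    (v := downRate K q₁ N)
    (fun n hn => by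
      rw [Finset.mem_Icc] at hn
      have hnN : n < N := by omega
      have hnM : (n : ℝ) ≤ M := by exact_mod_cast hn.2
      have hf := hfrac hn.1 hnN
      have hle : (n : ℝ) / N ≤ β := by rw [div_le_iff₀ hN0]; linarith
      refine ⟨?_, upRate_nonneg K hq₀.le hnN.le, ?_⟩
      · refine le_trans ?_ (pow_mul_le_downRate hK hq₁.le hnN.le)
        gcongr
        refine hc1.trans ?_
        gcongr
      · rw [upRate_div_downRate q₀ q₁ hn.1 hnN, ← hg]
        have h := one_sub_div_gK_ge hK hf hβ hle
        have : ((M : ℝ) - n) / N ≤ β - n / N := by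
          rw [sub_div]
          have : (M : ℝ) / N ≤ β := by rw [div_le_iff₀ hN0]; exact hM1
          linarith
        linarith)
    (fun n hn => by
      rw [Finset.mem_Ioo] at hn
      have hn0 : 0 < n := by omega
      have hnM : (M : ℝ) + 1 ≤ n := by exact_mod_cast hn.1
      have hnN : (n : ℝ) ≤ N := by exact_mod_cast hn.2.le
      have hf := hfrac hn0 hn.2
      have hle : β ≤ (n : ℝ) / N := by rw [le_div_iff₀ hN0]; linarith
      refine ⟨?_, downRate_nonneg K hq₁.le hn.2.le, ?_⟩
      · refine le_trans ?_ (pow_mul_le_upRate hK hq₀.le hn.2.le)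
        have : (0 : ℝ) ≤ N - n := by linarith
        gcongr
        refine hc0.trans ?_
        gcongr
      · rw [← inv_div, upRate_div_downRate q₀ q₁ hn0 hn.2, ← hg, inv_div]
        have h := one_sub_div_gK_ge hK hβ hf hle
        have : ((n : ℝ) - (M + 1)) / N ≤ n / N - β := by
          rw [sub_div]
          have : β ≤ ((M : ℝ) + 1) / N := by rw [le_div_iff₀ hN0]; exact hM2.le
          linarith
        linarith)
  refine (tsum_meanHolding_le_ofReal hK hq₀ hq₁ hW0 hW x).trans
    (ENNReal.ofReal_le_ofReal ((hWle x (Nat.lt_succ_iff.mp x.2)).trans ?_))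
  have hNM : (0 : ℝ) < N - M := sub_pos.mpr (by exact_mod_cast hMN)
  have hH : 0 ≤ harm N := harm_zero ▸ harm_mono (Nat.zero_le N)
  rw [add_mul]
  -- The factors `N` cancel because `M + 1 ≥ βN` and `N - M ≥ (1 - β)N`.
  refine add_le_add ?_ ?_
  · calc 2 * N * harm M / (c * (M + 1)) ≤ 2 * N * harm N / (c * (β * N)) := by
          gcongr
          exact harm_mono hMN.le
      _ = _ := by field_simp
  · calc 2 * N * harm (N - M - 1) / (c * (N - M)) ≤ 2 * N * harm N / (c * ((1 - β) * N)) := by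
          gcongr
          · exact harm_mono (by omega)
          · linarith
      _ = _ := by field_simp

/-- The lower bound holds because every agent changes its opinion at rate at most `1`. -/
theorem harm_le_tsum_meanHolding {K : ℕ} (hK : 1 ≤ K) {q₀ q₁ : ℝ} (hq₀ : q₀ ∈ Ioo (0 : ℝ) 1)
    (hq₁ : q₁ ∈ Ioo (0 : ℝ) 1) {N : ℕ} (x : Fin (N + 1))
    (hfin : ∑' k, ∫⁻ Y, CTMC.meanHolding (rate K q₀ q₁ N) (Y k)
      ∂(CTMC.jumpChainLaw (rate K q₀ q₁ N) x) ≠ ∞) :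
    ENNReal.ofReal ((harm x + harm (N - x) - harm N) / 2) ≤
      ∑' k, ∫⁻ Y, CTMC.meanHolding (rate K q₀ q₁ N) (Y k)
        ∂(CTMC.jumpChainLaw (rate K q₀ q₁ N) x) := by
  -- One step up lowers `harm (N - n)` by `1/(N - n)` and one step down lowers `harm n` by `1/n`.
  -- Times the rates, each loss is at most `1`, whence the factor `1/2`.
  refine ofReal_le_tsum_meanHolding hK hq₀.1 hq₁.1
    (W := fun n => (harm n + harm (N - n) - harm N) / 2) ?_ ?_ ?_ ?_ x hfin
  · intro n hn
    have := harm_add_le n (N - n)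
    rw [Nat.add_sub_cancel' hn] at this
    linarith
  · simp [harm_zero]
  · simp [harm_zero]
  · intro n h0 hN
    obtain ⟨m, rfl⟩ := Nat.exists_eq_add_of_le' h0
    obtain ⟨l, rfl⟩ := Nat.exists_eq_add_of_lt hN
    have hu := upRate_le K hq₀ hN.le
    have hv := downRate_le K hq₁ hN.le
    have hu0 := upRate_nonneg K hq₀.1.le hN.le
    have hv0 := downRate_nonneg K hq₁.1.le hN.le
    set u := upRate K q₀ (m + 1 + l + 1) (m + 1)
    set v := downRate K q₁ (m + 1 + l + 1) (m + 1)
    rw [show m + 1 + l + 1 - (m + 1) = l + 1 by omega,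
      show m + 1 + l + 1 - (m + 1 + 1) = l by omega,
      show m + 1 + l + 1 - (m + 1 - 1) = l + 1 + 1 by omega, Nat.add_sub_cancel,
      harm_succ (m + 1), harm_succ (l + 1), harm_succ l, harm_succ m]
    push_cast at hu hv ⊢
    have h1 : u * ((l : ℝ) + 1)⁻¹ ≤ 1 := by
      rw [← div_eq_mul_inv, div_le_one (by positivity)]; linarith
    have h2 : v * ((m : ℝ) + 1)⁻¹ ≤ 1 := by
      rw [← div_eq_mul_inv, div_le_one (by positivity)]; linarith
    have h3 : 0 ≤ u * ((m : ℝ) + 1 + 1)⁻¹ := by positivity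
    have h4 : 0 ≤ v * ((l : ℝ) + 1 + 1)⁻¹ := by positivity
    linarith

end MajorityRule

/-! ### Logarithmic asymptotics -/

theorem mainTheorem2 (K : ℕ) (hK : 1 ≤ K) (q₀ q₁ : ℝ)
    (hq₀ : q₀ ∈ Ioo (0 : ℝ) 1) (hq₁ : q₁ ∈ Ioo (0 : ℝ) 1) (hq : q₁ < q₀) :
    (∃! β : ℝ, β ∈ Ioo (0 : ℝ) 1 ∧ MajorityRule.gK K β = q₁ / q₀) ∧
    ∀ β ∈ Ioo (0 : ℝ) 1, MajorityRule.gK K β = q₁ / q₀ →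
      ∀ (α : ℝ) (hα : α ∈ Ioo (0 : ℝ) 1), α ≠ β →
        (∀ N : ℕ, MajorityRule.meanConsensusTime K q₀ q₁ N
          (MajorityRule.initialState α hα N) ≠ ∞) ∧
        (fun N : ℕ => (MajorityRule.meanConsensusTime K q₀ q₁ N
          (MajorityRule.initialState α hα N)).toReal) =Θ[atTop]
          (fun N : ℕ => Real.log N) := by
  refine ⟨MajorityRule.existsUnique_gK_eq hK (div_pos hq₁.1 hq₀.1) ((div_lt_one hq₀.1).mpr hq), ?_⟩
  intro β hβ hg α hα _
  obtain ⟨C, hC, hle⟩ := MajorityRule.exists_tsum_meanHolding_le hK hq₀.1 hq₁.1 hβ hg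
  have hfin := fun (N : ℕ) (x : Fin (N + 1)) => ne_top_of_le_ne_top ENNReal.ofReal_ne_top (hle N x)
  have heq := fun (N : ℕ) (x : Fin (N + 1)) =>
    MajorityRule.meanConsensusTime_eq hK hq₀.1 q₁ x (hfin N x)
  have hne : ∀ N : ℕ, MajorityRule.meanConsensusTime K q₀ q₁ N
      (MajorityRule.initialState α hα N) ≠ ∞ := fun N => by rw [heq]; exact hfin N _
  have hlog : Tendsto (fun N : ℕ => Real.log N) atTop atTop :=
    Real.tendsto_log_atTop.comp tendsto_natCast_atTop_atTop
  refine ⟨hne, ?_, ?_⟩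
  · refine IsBigO.of_bound (2 * C) ?_
    filter_upwards [hlog.eventually_ge_atTop 1] with N hN
    rw [Real.norm_of_nonneg ENNReal.toReal_nonneg, Real.norm_of_nonneg (by linarith)]
    have hH := MajorityRule.harm_le_one_add_log N
    refine ENNReal.toReal_le_of_le_ofReal (by positivity) ?_
    rw [heq]
    refine (hle N _).trans (ENNReal.ofReal_le_ofReal ?_)
    nlinarith
  -- The lower bound is at least `(log N - (1 - log α - log (1 - α))) / 2`; once the inner constant
  -- is at most `log N / 2`, this is at least `log N / 4`.
  · refine IsBigO.of_bound 4 ?_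
    filter_upwards [hlog.eventually_ge_atTop (2 * (1 - Real.log α - Real.log (1 - α))),
      hlog.eventually_ge_atTop 1, eventually_gt_atTop 0] with N h1 h2 hN
    have hN0 : (0 : ℝ) < N := by exact_mod_cast hN
    rw [Real.norm_of_nonneg (by linarith), Real.norm_of_nonneg ENNReal.toReal_nonneg]
    have hlow := MajorityRule.harm_le_tsum_meanHolding hK hq₀ hq₁ _
      (hfin N (MajorityRule.initialState α hα N))
    rw [← heq, ENNReal.ofReal_le_iff_le_toReal (hne N)] at hlow
    have hx : ((MajorityRule.initialState α hα N : Fin (N + 1)) : ℕ) = ⌊α * N⌋₊ := rfl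
    rw [hx] at hlow
    have hα0 := hα.1
    have hα1 : 0 < 1 - α := sub_pos.mpr hα.2
    have hfl : (⌊α * N⌋₊ : ℝ) ≤ α * N := Nat.floor_le (by positivity)
    have hfN : ⌊α * N⌋₊ ≤ N := by
      have : (⌊α * N⌋₊ : ℝ) ≤ N := hfl.trans (by nlinarith [hα.2])
      exact_mod_cast this
    have a1 : Real.log α + Real.log N ≤ MajorityRule.harm ⌊α * N⌋₊ := by
      rw [← Real.log_mul hα0.ne' hN0.ne']
      refine le_trans ?_ (MajorityRule.log_add_one_le_harm _)
      exact Real.log_le_log (by positivity) (Nat.lt_floor_add_one _).le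
    have a2 : Real.log (1 - α) + Real.log N ≤ MajorityRule.harm (N - ⌊α * N⌋₊) := by
      rw [← Real.log_mul hα1.ne' hN0.ne']
      refine le_trans ?_ (MajorityRule.log_add_one_le_harm _)
      refine Real.log_le_log (by positivity) ?_
      rw [Nat.cast_sub hfN]
      linarith
    have a3 := MajorityRule.harm_le_one_add_log N
    linarith
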